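/- Let $m$ be an even non-negative integer. For $\omega\in\{0,1\}^m$ and $S\subseteq\{1,\dots,m\}$ let $[\omega]_S=\{\alpha\in\{0,1\}^m:\alpha_i=\omega_i\text{ for all }i\in S\}$. For $A,B\subseteq\{0,1\}^m$ let $$A\,\square\, B=\{\omega\in\{0,1\}^m:\text{ there are disjoint }K,L\subseteq\{1,\dots,m\}\text{ with }[\omega]_K\subseteq A\text{ and }[\omega]_L\subseteq B\},$$ and let $\bar B=\{(1-\omega_1,\dots,1-\omega_m):\omega\in B\}$. Call $A$ increasing if $\omega'\in A$ whenever $\omega\in A$ and $\omega'_i\ge\omega_i$ for all $i$. Let $\hat\Omega_m$ be the set of all $\omega\in\{0,1\}^m$ such that $(\omega_{2i-1},\omega_{2i})\in\{(1,0),(0,1)\}$ for all $1\le i\le m/2$, and let $\hat P_m$ be the probability distribution on $\{0,1\}^m$ that is uniform on $\hat\Omega_m$ (and gives probability $0$ to every $\omega\notin\hat\Omega_m$). Then for all increasing $A,B\subseteq\{0,1\}^m$, $$\hat P_m(A\,\square\, B)\le\hat P_m(A\cap\bar B).$$ -/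

import Mathlib

/-- A configuration `ω ∈ {0,1}^ι`, with `true` standing for `1` and `false` for `0`. The order is
the coordinatewise one, and every set of configurations is an event when `ι` is finite. -/
abbrev Config (ι : Type*) : Type _ := ι → Bool

namespace Config

/-- The cylinder `[ω]_S`: the configurations that agree with `ω` on `S`. -/
def cylinder {ι : Type*} (ω : Config ι) (S : Set ι) : Set (Config ι) :=
  {α | ∀ i ∈ S, α i = ω i}

/-- The event `A □ B` that `A` and `B` occur disjointly. -/
def box {ι : Type*} (A B : Set (Config ι)) : Set (Config ι) :=
  {ω | ∃ K L : Set ι, Disjoint K L ∧ ω.cylinder K ⊆ A ∧ ω.cylinder L ⊆ B}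

/-- The flipped configuration `1 - ω`, with `0` and `1` interchanged in each coordinate. -/
def flip {ι : Type*} (ω : Config ι) : Config ι := fun i => !(ω i)

/-- The event `{flip ω : ω ∈ A}`. -/
def bar {ι : Type*} (A : Set (Config ι)) : Set (Config ι) := flip '' A

/-- The configurations of `{0,1}^m` in which each pair of consecutive coordinates with numbers
`2i-1, 2i` (counted from one; `2i, 2i+1` when counted from zero, as here) is `(1,0)` or `(0,1)`. -/
def pairConfigs (m : ℕ) : Set (Config (Fin m)) :=
  {ω | ∀ (i : ℕ) (h : 2 * i + 1 < m),
    (ω ⟨2 * i, by omega⟩, ω ⟨2 * i + 1, h⟩) = (true, false) ∨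
      (ω ⟨2 * i, by omega⟩, ω ⟨2 * i + 1, h⟩) = (false, true)}

/-- The uniform distribution on `pairConfigs m`, as a measure on `{0,1}^m`. -/
noncomputable def pairMeasure (m : ℕ) : MeasureTheory.Measure (Config (Fin m)) :=
  ProbabilityTheory.uniformOn (pairConfigs m)

theorem pairConfigs_nonempty (m : ℕ) : (pairConfigs m).Nonempty := by
  refine ⟨fun i => decide (i.val % 2 = 0), fun i h => Or.inl ?_⟩
  have h1 : (2 * i + 1) % 2 = 1 := by omega
  simp [h1]

instance isProbabilityMeasure_pairMeasure (m : ℕ) :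
    MeasureTheory.IsProbabilityMeasure (pairMeasure m) :=
  ProbabilityTheory.isProbabilityMeasure_uniformOn (Set.toFinite _) (pairConfigs_nonempty m)

end Config

/-! On the cube, a dimension count gives `ncard_box_le`. Each `x` in `box A B` has `S` with `[x]_S ⊆
A` and `[x]_{Sᶜ} ⊆ B`; it yields a red vector supported on `A` and a yellow one supported on `bar
B`, with `gram` sending yellow to red. If a red combination `r` vanishes on `A ∩ bar B`, its yellow
counterpart `w` satisfies `wᵀ gram w = wᵀ r = 0`, so `w = 0` by definiteness, so `r = 0`; red
vectors are independent, so there are at most `|A ∩ bar B|` of them. `double` carries this to pair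
configurations via `preimage_double_box_subset`. -/

namespace Config

/-! ### Reimer's inequality on the cube, by linear algebra -/

section Reimer

variable {ι : Type*} [Fintype ι]

/-- The tensor power of the matrix `!![2, 1; 1, 2]`. -/
def gram (y z : Config ι) : ℤ := ∏ i, if y i = z i then 2 else 1

/-- A product vector supported on the cylinder `[x]_S`, congruent to the indicator of `x` modulo
two. -/
def redVec (S : Set ι) [DecidablePred (· ∈ S)] (x y : Config ι) : ℤ :=
  ∏ i, if i ∈ S then (if y i = x i then 3 else 0) else (if y i = x i then 1 else 2)

/-- A product vector supported on the flip of the cylinder `[x]_{Sᶜ}`. -/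
def yellowVec (S : Set ι) [DecidablePred (· ∈ S)] (x y : Config ι) : ℤ :=
  ∏ i, if i ∈ S then (if y i = x i then 2 else -1) else (if y i = x i then 0 else 1)

theorem sum_prod_eq_prod_sum [DecidableEq ι] (f : ι → Bool → ℤ) :
    ∑ z : Config ι, ∏ i, f i (z i) = ∏ i, (f i true + f i false) := by
  have h := Finset.prod_univ_sum (fun _ : ι => (Finset.univ : Finset Bool)) f
  rw [Fintype.piFinset_univ] at h
  rw [← h]
  simp

/-- Coordinatewise, `!![2, 1; 1, 2]` sends `(2, -1)` to `(3, 0)` and `(0, 1)` to `(1, 2)`. -/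
theorem sum_gram_mul_yellowVec [DecidableEq ι] (S : Set ι) [DecidablePred (· ∈ S)] (x y : Config ι) :
    ∑ z, gram y z * yellowVec S x z = redVec S x y := by
  simp only [gram, yellowVec, redVec, ← Finset.prod_mul_distrib]
  rw [sum_prod_eq_prod_sum (fun i b => (if y i = b then (2 : ℤ) else 1) *
    if i ∈ S then (if b = x i then 2 else -1) else (if b = x i then 0 else 1))]
  refine Finset.prod_congr rfl fun i _ => ?_
  by_cases hi : i ∈ S <;> cases y i <;> cases x i <;> simp [hi]

/-- The factor at one coordinate of the square root of `gram`. -/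
def gramFactor (k : Option Bool) (b : Bool) : ℤ := k.elim 1 fun c => if b = c then 1 else 0

theorem gram_eq_sum [DecidableEq ι] (y z : Config ι) :
    gram y z = ∑ κ : ι → Option Bool,
      (∏ i, gramFactor (κ i) (y i)) * ∏ i, gramFactor (κ i) (z i) := by
  have h := Finset.prod_univ_sum (fun _ : ι => (Finset.univ : Finset (Option Bool)))
    (fun i k => gramFactor k (y i) * gramFactor k (z i))
  rw [Fintype.piFinset_univ] at h
  simp only [← Finset.prod_mul_distrib]
  rw [← h]
  refine Finset.prod_congr rfl fun i _ => ?_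
  cases y i <;> cases z i <;> simp [gramFactor, Fintype.sum_option]

theorem prod_gramFactor_some (x y : Config ι) :
    ∏ i, gramFactor (some (x i)) (y i) = if y = x then 1 else 0 := by
  simp only [gramFactor, Option.elim_some]
  split_ifs with h
  · simp [h]
  · obtain ⟨i, hi⟩ := Function.ne_iff.mp h
    exact Finset.prod_eq_zero (Finset.mem_univ i) (if_neg hi)

/-- The form is a sum of squares; the square indexed by `some ∘ x` is `(w x) ^ 2`. -/
theorem eq_zero_of_gram_form_eq_zero [DecidableEq ι] (w : Config ι → ℤ)
    (h : ∑ y, w y * ∑ z, gram y z * w z = 0) : w = 0 := by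
  have hsq : ∑ κ : ι → Option Bool, (∑ y, w y * ∏ i, gramFactor (κ i) (y i)) ^ 2 = 0 := by
    rw [← h]
    simp only [gram_eq_sum, Finset.mul_sum, Finset.sum_mul, sq]
    rw [Finset.sum_comm]
    refine (Finset.sum_congr rfl fun z _ => Finset.sum_comm).trans ?_
    rw [Finset.sum_comm]
    refine Finset.sum_congr rfl fun y _ => Finset.sum_congr rfl fun z _ =>
      Finset.sum_congr rfl fun κ _ => by ring
  rw [Finset.sum_eq_zero_iff_of_nonneg fun _ _ => sq_nonneg _] at hsq
  funext x
  simpa [prod_gramFactor_some] using hsq (fun i => some (x i)) (Finset.mem_univ _)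

theorem redVec_cast_zmod_two (S : Set ι) [DecidablePred (· ∈ S)] (x y : Config ι) :
    (redVec S x y : ZMod 2) = if x = y then 1 else 0 := by
  rw [redVec, Int.cast_prod]
  split_ifs with h
  · refine Finset.prod_eq_one fun i _ => ?_
    subst h
    by_cases hi : i ∈ S
    · simp only [hi, if_true]; decide
    · simp [hi]
  · obtain ⟨i, hi⟩ := Function.ne_iff.mp h
    refine Finset.prod_eq_zero (Finset.mem_univ i) ?_
    by_cases hS : i ∈ S
    · simp [hS, Ne.symm hi]
    · simp only [hS, Ne.symm hi, if_false]; decide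

open Classical in
-- Modulo two the matrix is the identity, whatever `S` is, so the determinant is odd.
theorem det_redVec_ne_zero (S : Config ι → Set ι) :
    (Matrix.of fun x y => redVec (S x) x y).det ≠ 0 := by
  intro h
  have h1 := congrArg (Int.castRingHom (ZMod 2)) h
  rw [RingHom.map_det, map_zero] at h1
  have h2 : (Int.castRingHom (ZMod 2)).mapMatrix (Matrix.of fun x y => redVec (S x) x y) = 1 := by
    ext x y
    simp [redVec_cast_zmod_two, Matrix.one_apply]
  rw [h2, Matrix.det_one] at h1
  exact one_ne_zero h1

theorem mem_cylinder_of_redVec_ne_zero {S : Set ι} [DecidablePred (· ∈ S)] {x y : Config ι}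
    (h : redVec S x y ≠ 0) : y ∈ x.cylinder S := by
  intro i hi
  have := Finset.prod_ne_zero_iff.mp h i (Finset.mem_univ i)
  by_contra hne
  simp [hi, hne] at this

theorem flip_mem_cylinder_of_yellowVec_ne_zero {S : Set ι} [DecidablePred (· ∈ S)]
    {x y : Config ι} (h : yellowVec S x y ≠ 0) : flip y ∈ x.cylinder Sᶜ := by
  intro i hi
  have := Finset.prod_ne_zero_iff.mp h i (Finset.mem_univ i)
  by_contra hne
  have hyx : y i = x i := by
    revert hne
    cases hy : y i <;> cases hx : x i <;> simp [flip, hy]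
  exact this (by rw [if_neg hi, if_pos hyx])


/-- **Reimer's theorem** on the cube. -/
theorem ncard_box_le (A B : Set (Config ι)) : (box A B).ncard ≤ (A ∩ bar B).ncard := by
  classical
  have hS : ∀ x : Config ι, ∃ S : Set ι, x ∈ box A B → x.cylinder S ⊆ A ∧ x.cylinder Sᶜ ⊆ B := by
    intro x
    by_cases hx : x ∈ box A B
    · obtain ⟨K, L, hKL, hK, hL⟩ := hx
      exact ⟨K, fun _ => ⟨hK, fun y hy => hL fun i hi =>
        hy i (Set.disjoint_right.mp hKL hi)⟩⟩
    · exact ⟨∅, fun h => absurd h hx⟩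
  choose S hS using hS
  let r (c : box A B → ℤ) (y : Config ι) : ℤ := ∑ x, c x * redVec (S x) x y
  let w (c : box A B → ℤ) (y : Config ι) : ℤ := ∑ x, c x * yellowVec (S x) x y
  have hrw (c : box A B → ℤ) (y : Config ι) : ∑ z, gram y z * w c z = r c y := by
    simp only [w, r, Finset.mul_sum, ← sum_gram_mul_yellowVec]
    rw [Finset.sum_comm]
    exact Finset.sum_congr rfl fun x _ => Finset.sum_congr rfl fun z _ => by ring
  have hr (c : box A B → ℤ) (y : Config ι) (hy : y ∉ A) : r c y = 0 := by
    refine Finset.sum_eq_zero fun x _ => mul_eq_zero_of_right _ ?_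
    by_contra h
    exact hy ((hS x x.2).1 (mem_cylinder_of_redVec_ne_zero h))
  have hw (c : box A B → ℤ) (y : Config ι) (hy : y ∉ bar B) : w c y = 0 := by
    refine Finset.sum_eq_zero fun x _ => mul_eq_zero_of_right _ ?_
    by_contra h
    exact hy ⟨flip y, (hS x x.2).2 (flip_mem_cylinder_of_yellowVec_ne_zero h),
      by funext i; simp [flip]⟩
  let F : (box A B → ℤ) →ₗ[ℤ] ((A ∩ bar B : Set (Config ι)) → ℤ) :=
    { toFun := fun c y => r c y
      map_add' := fun c d => by
        funext y; simp [r, add_mul, Finset.sum_add_distrib]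
      map_smul' := fun a c => by
        funext y; simp [r, mul_assoc, Finset.mul_sum] }
  have hF : Function.Injective F := by
    rw [← LinearMap.ker_eq_bot, LinearMap.ker_eq_bot']
    intro c hc
    have hform : ∑ y, w c y * ∑ z, gram y z * w c z = 0 := by
      refine Finset.sum_eq_zero fun y _ => ?_
      rw [hrw]
      by_cases hA : y ∈ A
      · by_cases hB : y ∈ bar B
        · rw [show r c y = 0 from congrFun hc ⟨y, hA, hB⟩, mul_zero]
        · rw [hw c y hB, zero_mul]
      · rw [hr c y hA, mul_zero]
    have hw0 := eq_zero_of_gram_form_eq_zero _ hform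
    have hr0 (y : Config ι) : r c y = 0 := by rw [← hrw, hw0]; simp
    have hvec := Matrix.eq_zero_of_vecMul_eq_zero (det_redVec_ne_zero S)
      (v := fun x => if h : x ∈ box A B then c ⟨x, h⟩ else 0) (by
        funext y
        refine Eq.trans ?_ (hr0 y)
        simp only [Matrix.vecMul, dotProduct, Matrix.of_apply, r]
        rw [← Finset.sum_subset (Finset.subset_univ (box A B).toFinset) fun x _ hx => by
          rw [dif_neg (by simpa using hx), zero_mul],
          Finset.sum_subtype _ fun x => Set.mem_toFinset]
        exact Finset.sum_congr rfl fun x _ => by rw [dif_pos x.2])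
    funext x
    simpa using congrFun hvec x
  have := LinearMap.finrank_le_finrank_of_injective hF
  simpa [Module.finrank_fintype_fun_eq_card, ← Nat.card_eq_fintype_card,
    Nat.card_coe_set_eq] using this

end Reimer

/-! ### Transfer to pair configurations -/

/-- The pair configuration of `{0,1}^(2k)` in which the `i`-th pair is `(x i, 1 - x i)`. -/
def double {k : ℕ} (x : Config (Fin k)) : Config (Fin (k + k)) := fun j =>
  if j.val % 2 = 0 then x ⟨j.val / 2, by omega⟩ else !x ⟨j.val / 2, by omega⟩

theorem double_injective {k : ℕ} : Function.Injective (double (k := k)) := by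
  intro x y h
  funext i
  have := congrFun h ⟨2 * i.val, by omega⟩
  simpa [double] using this

theorem double_flip {k : ℕ} (x : Config (Fin k)) : double (flip x) = flip (double x) := by
  funext j
  simp only [double, flip]
  split_ifs <;> rfl

theorem flip_flip {ι : Type*} (x : Config ι) : flip (flip x) = x := by
  funext i
  simp [flip]

theorem mem_bar {ι : Type*} {A : Set (Config ι)} {x : Config ι} : x ∈ bar A ↔ flip x ∈ A := by
  constructor
  · rintro ⟨y, hy, rfl⟩
    rwa [flip_flip]
  · exact fun h => ⟨_, h, flip_flip x⟩

theorem range_double (k : ℕ) : Set.range (double (k := k)) = pairConfigs (k + k) := by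
  ext ω
  constructor
  · rintro ⟨x, rfl⟩ i h
    have h2 : (2 * i + 1) / 2 = i := by omega
    have h3 : (2 * i + 1) % 2 = 1 := by omega
    cases hx : x ⟨i, by omega⟩ <;> simp [double, h2, h3, hx]
  · intro h
    refine ⟨fun i => ω ⟨2 * i.val, by omega⟩, ?_⟩
    funext ⟨j, hj⟩
    rcases Nat.even_or_odd' j with ⟨i, rfl | rfl⟩
    · simp [double]
    · have h2 : (2 * i + 1) / 2 = i := by omega
      have h3 : (2 * i + 1) % 2 = 1 := by omega
      rcases h i hj with h | h <;> simp_all [double]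

/-- Only the ones of a witness set matter for an increasing event, and each pair holds exactly one
1, so no pair serves both witnesses. -/
theorem preimage_double_box_subset {k : ℕ} {A B : Set (Config (Fin (k + k)))}
    (hA : IsUpperSet A) (hB : IsUpperSet B) :
    double ⁻¹' box A B ⊆ box (double ⁻¹' A) (double ⁻¹' B) := by
  classical
  rintro x ⟨K, L, hKL, hK, hL⟩
  -- The position of the 1 in the `i`-th pair of `double x`.
  let one (i : Fin k) : Fin (k + k) := ⟨2 * i.val + if x i then 0 else 1, by split_ifs <;> omega⟩
  have key (C : Set (Config (Fin (k + k)))) (hC : IsUpperSet C) (M : Set (Fin (k + k)))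
      (hM : (double x).cylinder M ⊆ C) : x.cylinder (one ⁻¹' M) ⊆ double ⁻¹' C := by
    intro y hy
    -- The least element of the cylinder; it suffices that `double y` lies above it.
    refine hC (a := fun j => if j ∈ M then double x j else false) ?_
      (hM fun j hj => by simp [hj])
    intro j
    by_cases hj : j ∈ M
    · simp only [hj, if_true]
      cases hx : double x j with
      | false => exact Bool.false_le _
      | true =>
        have hone : one ⟨j.val / 2, by omega⟩ = j := by
          ext
          simp only [double] at hx
          simp only [one]
          split_ifs at hx ⊢ <;> first | omega | simp_all
        have hyx := hy ⟨j.val / 2, by omega⟩ (by rw [Set.mem_preimage, hone]; exact hj)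
        rw [← hx]
        simp [double, hyx]
    · simp [hj]
  exact ⟨one ⁻¹' K, one ⁻¹' L, hKL.preimage _, key A hA K hK, key B hB L hL⟩

theorem pairMeasure_apply (k : ℕ) (A : Set (Config (Fin (k + k)))) :
    pairMeasure (k + k) A =
      (MeasureTheory.Measure.count (pairConfigs (k + k)))⁻¹ * ((double ⁻¹' A).ncard : ENNReal) := by
  rw [pairMeasure, ProbabilityTheory.uniformOn, ProbabilityTheory.cond_apply
    (Set.toFinite _).measurableSet, ← range_double, Set.inter_comm,
    ← Set.image_preimage_eq_inter_range,
    MeasureTheory.Measure.count_injective_image double_injective]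
  rw [MeasureTheory.Measure.count_apply_finite (double ⁻¹' A) (Set.toFinite _),
    Set.ncard_eq_toFinset_card]

end Config

theorem mainTheorem3 (m : ℕ) (hm : Even m) (A B : Set (Config (Fin m)))
    (hA : IsUpperSet A) (hB : IsUpperSet B) :
    Config.pairMeasure m (Config.box A B) ≤ Config.pairMeasure m (A ∩ Config.bar B) := by
  obtain ⟨k, rfl⟩ := hm
  rw [Config.pairMeasure_apply, Config.pairMeasure_apply]
  refine mul_le_mul_right (Nat.cast_le.mpr ?_) _
  refine (Set.ncard_le_ncard (Config.preimage_double_box_subset hA hB)).trans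
    ((Config.ncard_box_le _ _).trans_eq ?_)
  congr 1
  ext x
  simp [Config.mem_bar, Config.double_flip]
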